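/- **Setting.** Let $\nu_1,\dots,\nu_d$ be probability measures on $\mathbb R$ (the laws of independent input variables $\Xi_1,\dots,\Xi_d$) and $f=\nu_1\otimes\cdots\otimes\nu_d$ the law of $\Xi$. For each $i$ let $\psi_{i,0},\psi_{i,1},\dots$ be polynomials, $\psi_{i,n}$ of degree $n$, orthonormal in $L^2(\nu_i)$ (only the degrees up to the largest one used below are needed). Let $\mathcal B$ be a finite set of multi-indices $\bm k\in\mathbb N_0^d$ with $|\mathcal B|>1$ (for instance the index set of an anisotropic total order basis), with basis functions $\psi_{\bm k}(\xi)=\prod_i\psi_{i,k_i}(\xi_i)$; for $\bm c\in\mathbb R^{\mathcal B}$ write $u_{\bm c}=\sum_{\bm k\in\mathcal B}c_{\bm k}\psi_{\bm k}$. For a target $u\in L^2(f)$ with $\mathbb E\,u(\Xi)^2>0$ put $$\mathrm{RMSE}(v)=\sqrt{\mathbb E(v(\Xi)-u(\Xi))^2},\qquad \mathrm{RRMSE}(v)=\mathrm{RMSE}(v)/\sqrt{\mathbb E\,u(\Xi)^2},$$ and let $\tilde u=u_{\tilde{\bm c}}$ minimize RRMSE among all $u_{\bm c}$. For sample points $\xi^{(1)},\dots,\xi^{(N)}$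 and a measurable weight function $w$, let $\bm u=(u(\xi^{(i)}))_i$, $\bm\Psi=(\psi_{\bm k}(\xi^{(i)}))_{i,\bm k}$, $\bm W=\mathrm{diag}(w(\xi^{(i)})/\sqrt N)$ and $\bm D=\bm W\bm\Psi$. The computed surrogate for the tolerance $\delta$ is $\hat u=u_{\hat{\bm c}}$, where $\hat{\bm c}$ is any solution of $$\min_{\bm c}\|\bm c\|_1\quad\text{subject to}\quad \|\bm W(\bm u-\bm\Psi\bm c)\|_2\le\delta\|\bm W\bm u\|_2 .$$ **Coupling.** The $N$ samples of the given iteration have some joint law $Q$ (they may be dependent) and weight function $w$. Let $g_\star$ be a probability measure carried by a set $\Omega$, and $w_\star$ a measurable weight function with $\int w_\star^2\psi_{\bm k}\psi_{\bm l}\,dg_\star=\delta_{\bm k\bm l}$ for $\bm k,\bm l\in\mathcal B$ (so that $\mathbb E(\bm D_\star^T\bm D_\star)=\bm I$ for the design matrix $\bm D_\star$ of $N$ independent samples from $g_\star$ with weights $w_\star$) and with finite coherence $$\mu_\star(|\mathcal B|)=\sup_{\xi\in\Omega}\ \max_{\mathcal S\subseteq\mathcal B,\ |\mathcal S|\le|\mathcal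 B|}\ \sum_{\bm k\in\mathcal S}|w_\star(\xi)\psi_{\bm k}(\xi)|^2 .$$ We say that $\bm D$ is non-sparse-coupled to $\bm D_\star$ at level $t$ with constants $\beta\in\mathbb R$ and $\kappa_t>0$ if there is a coupling of $Q$ and $g_\star^{\otimes N}$ under which $$\mathbb P\bigl(\|\bm D^T\bm D-\bm D_\star^T\bm D_\star\|>t\bigr)\le\beta\exp\Bigl(-\frac{\kappa_t N}{\mu_\star(|\mathcal B|)\log|\mathcal B|}\Bigr),$$ with the $\ell_2$ operator norm. Put $\beta_\star=\max(\beta,1)$. **Theorem (Non-Sparse Recovery).** Let $t=3/(4+\sqrt6)$. There are constants $D_1=D_1(t,L)$, depending only on $t$ and on a real number $L$, and for all $\beta\in\mathbb R$ and $\kappa_t>0$ there is $\kappa'_t>0$, depending only on $t$, $\beta$ and $\kappa_t$, such that the following holds in every setting as above. If $\bm D$ is non-sparse-coupled to $\bm D_\star$ at level $t$ with constants $\beta,\kappa_t$, and if, for some $C\in\mathbb R$, $$N\ \ge\ (C+\log(2\beta_\star))\,(\kappa'_t)^{-1}\,\mu_\star(|\mathcal B|)\,\log|\mathcal B| ,$$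 then there is an event for the samples, of probability at least $1-e^{-C}$, on which simultaneously for all targets $u\in L^2(f)$ with $\mathbb E\,u(\Xi)^2>0$, all $L$ and all tolerances $\delta$ with $$\|\bm W(\bm u-\bm\Psi\tilde{\bm c})\|_2\ \le\ \delta\|\bm W\bm u\|_2\ \le\ L\cdot\mathrm{RMSE}(\tilde u),$$ every computed surrogate satisfies $$\mathrm{RRMSE}(\hat u)\le D_1\,\mathrm{RRMSE}(\tilde u).$$ -/

import Mathlib

open MeasureTheory

namespace BasePC

noncomputable section

/-- `P 0, ..., P r` are polynomials of degrees `0, ..., r`, orthonormal with respect to the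
distribution `ν` of one input variable. -/
def IsOrthonormalUpTo (ν : Measure ℝ) (P : ℕ → Polynomial ℝ) (r : ℕ) : Prop :=
  (∀ n ≤ r, (P n).natDegree = n) ∧
    ∀ m ≤ r, ∀ n ≤ r, ∫ x, (P m).eval x * (P n).eval x ∂ν = if m = n then 1 else 0

/-- The tensorized polynomial chaos basis function with multi-index `k`. -/
def pcBasis {d : ℕ} (P : Fin d → ℕ → Polynomial ℝ) (k : Fin d → ℕ) (x : Fin d → ℝ) : ℝ :=
  ∏ i, (P i (k i)).eval (x i)

/-- The approximation with coefficients `c` in the basis with multi-indices in `B`. -/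
def surrogate {d : ℕ} (P : Fin d → ℕ → Polynomial ℝ) (B : Finset (Fin d → ℕ)) (c : B → ℝ)
    (x : Fin d → ℝ) : ℝ :=
  ∑ k : B, c k * pcBasis P k x

/-- Root-mean-square error of `v` as an approximation of `u`. -/
def rmse {X : Type*} [MeasurableSpace X] (f : Measure X) (u v : X → ℝ) : ℝ :=
  Real.sqrt (∫ x, (v x - u x) ^ 2 ∂f)

/-- Relative root-mean-square error of `v` as an approximation of `u`. -/
def rrmse {X : Type*} [MeasurableSpace X] (f : Measure X) (u v : X → ℝ) : ℝ :=
  rmse f u v / Real.sqrt (∫ x, u x ^ 2 ∂f)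

/-- `c` are the coefficients of a best approximation of `u` in the basis, in the sense of RRMSE. -/
def IsBestApprox {d : ℕ} (f : Measure (Fin d → ℝ)) (P : Fin d → ℕ → Polynomial ℝ)
    (B : Finset (Fin d → ℕ)) (u : (Fin d → ℝ) → ℝ) (c : B → ℝ) : Prop :=
  ∀ c' : B → ℝ, rrmse f u (surrogate P B c) ≤ rrmse f u (surrogate P B c')

/-- The measurement matrix `Ψ` at the samples `ξ`. -/
def measurementMatrix {d N : ℕ} (P : Fin d → ℕ → Polynomial ℝ) (B : Finset (Fin d → ℕ))
    (ξ : Fin N → Fin d → ℝ) : Matrix (Fin N) B ℝ :=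
  Matrix.of fun i k => pcBasis P k (ξ i)

/-- The diagonal weight matrix `W`, in the normalization that gives `E(Dᵀ D) = I`. -/
def weightMatrix {d N : ℕ} (w : (Fin d → ℝ) → ℝ) (ξ : Fin N → Fin d → ℝ) :
    Matrix (Fin N) (Fin N) ℝ :=
  Matrix.diagonal fun i => w (ξ i) / Real.sqrt N

/-- The design matrix `D = W Ψ`. -/
def designMatrix {d N : ℕ} (P : Fin d → ℕ → Polynomial ℝ) (B : Finset (Fin d → ℕ))
    (w : (Fin d → ℝ) → ℝ) (ξ : Fin N → Fin d → ℝ) : Matrix (Fin N) B ℝ :=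
  weightMatrix w ξ * measurementMatrix P B ξ

/-- Euclidean norm of a vector. -/
def l2norm {ι : Type*} [Fintype ι] (v : ι → ℝ) : ℝ := ‖WithLp.toLp 2 v‖

/-- `ℓ₁` norm of a vector. -/
def l1norm {ι : Type*} [Fintype ι] (v : ι → ℝ) : ℝ := ∑ i, |v i|

/-- `ℓ₂` operator norm of a square matrix. -/
def opNorm {ι : Type*} [Fintype ι] [DecidableEq ι] (A : Matrix ι ι ℝ) : ℝ :=
  ‖Matrix.toEuclideanCLM (𝕜 := ℝ) A‖

/-- `‖W (u - Ψ c)‖₂`, the weighted residual at the samples. -/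
def residual {d N : ℕ} (P : Fin d → ℕ → Polynomial ℝ) (B : Finset (Fin d → ℕ))
    (w : (Fin d → ℝ) → ℝ) (ξ : Fin N → Fin d → ℝ) (u : (Fin d → ℝ) → ℝ) (c : B → ℝ) : ℝ :=
  l2norm ((weightMatrix w ξ).mulVec
    ((fun i => u (ξ i)) - (measurementMatrix P B ξ).mulVec c))

/-- `δ ‖W u‖₂`, the radius of the constraint in the `ℓ₁`-minimization. -/
def tolerance {d N : ℕ} (w : (Fin d → ℝ) → ℝ) (ξ : Fin N → Fin d → ℝ)
    (u : (Fin d → ℝ) → ℝ) (δ : ℝ) : ℝ :=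
  δ * l2norm ((weightMatrix w ξ).mulVec (fun i => u (ξ i)))

/-- `c` solves: minimize `‖c‖₁` subject to `‖W (u - Ψ c)‖₂ ≤ δ ‖W u‖₂`. -/
def IsL1Solution {d N : ℕ} (P : Fin d → ℕ → Polynomial ℝ) (B : Finset (Fin d → ℕ))
    (w : (Fin d → ℝ) → ℝ) (ξ : Fin N → Fin d → ℝ) (u : (Fin d → ℝ) → ℝ) (δ : ℝ)
    (c : B → ℝ) : Prop :=
  residual P B w ξ u c ≤ tolerance w ξ u δ ∧
    ∀ c' : B → ℝ, residual P B w ξ u c' ≤ tolerance w ξ u δ → l1norm c ≤ l1norm c'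

/-- The numbers `∑ k ∈ S, |w(x) ψ_k(x)|²` with `x ∈ Ω` and `|S| ≤ s`. -/
def coherenceSet {d : ℕ} (Ω : Set (Fin d → ℝ)) (P : Fin d → ℕ → Polynomial ℝ)
    (B : Finset (Fin d → ℕ)) (w : (Fin d → ℝ) → ℝ) (s : ℕ) : Set ℝ :=
  {r | ∃ x ∈ Ω, ∃ S : Finset B, S.card ≤ s ∧ r = ∑ k ∈ S, |w x * pcBasis P k x| ^ 2}

/-- The coherence parameter `μ₂(s)`. -/
def coherence {d : ℕ} (Ω : Set (Fin d → ℝ)) (P : Fin d → ℕ → Polynomial ℝ)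
    (B : Finset (Fin d → ℕ)) (w : (Fin d → ℝ) → ℝ) (s : ℕ) : ℝ :=
  sSup (coherenceSet Ω P B w s)

/-- Sampling from `g` with weight function `w` is isotropic in the given basis, that is
`E(Dᵀ D) = I` for independent samples from `g`. -/
def IsIsotropic {d : ℕ} (g : Measure (Fin d → ℝ)) (P : Fin d → ℕ → Polynomial ℝ)
    (B : Finset (Fin d → ℕ)) (w : (Fin d → ℝ) → ℝ) : Prop :=
  ∀ k l : B, ∫ x, w x ^ 2 * pcBasis P k x * pcBasis P l x ∂g = if k = l then 1 else 0

/-- The design matrix of `N` samples with joint law `Q` and weight function `w` is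
non-sparse-coupled at level `t`, with constants `β` and `κ`, to the design matrix of `N`
independent samples from `g` with weight function `wg`. A coupling is a joint law with the two
given marginals. -/
def NonSparseCoupled {d N : ℕ} (Ω : Set (Fin d → ℝ)) (P : Fin d → ℕ → Polynomial ℝ)
    (B : Finset (Fin d → ℕ)) (Q : Measure (Fin N → Fin d → ℝ)) (w : (Fin d → ℝ) → ℝ)
    (g : Measure (Fin d → ℝ)) (wg : (Fin d → ℝ) → ℝ) (t β κ : ℝ) : Prop :=
  ∃ J : Measure ((Fin N → Fin d → ℝ) × (Fin N → Fin d → ℝ)),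
    J.map Prod.fst = Q ∧ J.map Prod.snd = Measure.pi (fun _ => g) ∧
    J.real {p | t < opNorm
        ((designMatrix P B w p.1).transpose * designMatrix P B w p.1 -
          (designMatrix P B wg p.2).transpose * designMatrix P B wg p.2)} ≤
      β * Real.exp (-(κ * N / (coherence Ω P B wg B.card * Real.log B.card)))

end

end BasePC

/-! The error bound is deterministic once the Gram matrix `Dᵀ D` is at least `1/4` as a quadratic
form. The best approximation and the computed surrogate are both feasible for one tolerance `T`, so
`D` maps the difference of their coefficients to a vector of length at most `2T`; the lower bound
turns this into an `ℓ₂` bound on the coefficients, which Parseval and Minkowski convert to RMSE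
(`rrmse_le_of_mem_gramLowerBound`).

The probabilistic task is therefore only a lower spectral bound. The coupling moves it to
independent samples at the cost of `t ≤ 1/2`, so a bound by `3/4` is enough there.

For independent samples the potential `tr (S + s)⁻ᵖ` of the partial sum `S` is followed. A random
isotropic rank-one term with squared norm at most `μ` lowers its mean at least as much as raising
`s` by `1 - ε`, provided `p μ ≤ ε s` (`lintegral_resolventTrace_add_le`). After `m` samples the mean
is at most the potential of a multiple of the identity, and Markov's inequality gives failure
probability `|B| τᵖ` (`measure_pi_le`). The choice `p ∼ log |B| + C` absorbs the dimension factor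
and leads to `N ≳ μ (log |B| + C)`, which the sampling rate of the theorem implies. -/

namespace BasePC
open Matrix

/-! ### Traces of resolvent powers under rank-one updates and shifts. -/

section ResolventTrace

variable {ι : Type*} [Fintype ι]

/-- Chebyshev's association inequality for the weights `a i * r i`: the functions `r ^ m` and `r ^
n` are similarly ordered, so the symmetrized double sum is nonnegative. -/
theorem sum_mul_pow_mul_sum_mul_pow_le {a r : ι → ℝ} (ha : ∀ i, 0 ≤ a i) (hr : ∀ i, 0 ≤ r i)
    (m n : ℕ) :
    (∑ i, a i * r i ^ (m + 1)) * (∑ i, a i * r i ^ (n + 1)) ≤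
      (∑ i, a i * r i ^ 1) * ∑ i, a i * r i ^ (m + n + 1) := by
  have key : ∀ x y : ℝ, 0 ≤ x → 0 ≤ y → 0 ≤ (x ^ m - y ^ m) * (x ^ n - y ^ n) := by
    intro x y hx hy
    rcases le_total x y with h | h
    · exact mul_nonneg_of_nonpos_of_nonpos (sub_nonpos.2 (pow_le_pow_left₀ hx h m))
        (sub_nonpos.2 (pow_le_pow_left₀ hx h n))
    · exact mul_nonneg (sub_nonneg.2 (pow_le_pow_left₀ hy h m))
        (sub_nonneg.2 (pow_le_pow_left₀ hy h n))
  have h0 : 0 ≤ ∑ i, ∑ j, (a i * r i) * (a j * r j) *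
      ((r i ^ m - r j ^ m) * (r i ^ n - r j ^ n)) :=
    Finset.sum_nonneg fun i _ => Finset.sum_nonneg fun j _ =>
      mul_nonneg (mul_nonneg (mul_nonneg (ha i) (hr i)) (mul_nonneg (ha j) (hr j)))
        (key _ _ (hr i) (hr j))
  have e : ∀ f g : ι → ℝ, ∑ i, ∑ j, f i * g j = (∑ i, f i) * ∑ j, g j := fun f g =>
    (Finset.sum_mul_sum _ _ _ _).symm
  have h1 : ∑ i, ∑ j, (a i * r i) * (a j * r j) * ((r i ^ m - r j ^ m) * (r i ^ n - r j ^ n)) =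
      2 * ((∑ i, a i * r i ^ 1) * ∑ i, a i * r i ^ (m + n + 1)) -
      2 * ((∑ i, a i * r i ^ (m + 1)) * (∑ i, a i * r i ^ (n + 1))) := by
    have : ∀ i j, (a i * r i) * (a j * r j) * ((r i ^ m - r j ^ m) * (r i ^ n - r j ^ n)) =
        (a i * r i ^ (m + n + 1)) * (a j * r j ^ 1) + (a i * r i ^ 1) * (a j * r j ^ (m + n + 1))
        - (a i * r i ^ (m + 1)) * (a j * r j ^ (n + 1))
        - (a i * r i ^ (n + 1)) * (a j * r j ^ (m + 1)) := fun i j => by ring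
    simp only [this, Finset.sum_sub_distrib, Finset.sum_add_distrib, e]
    ring
  linarith

theorem mul_vecMulVec_mul_eq (X Z : Matrix ι ι ℝ) (y : ι → ℝ) :
    (X * vecMulVec y y * Z).trace = y ⬝ᵥ (Z * X) *ᵥ y := by
  rw [trace_mul_comm, ← Matrix.mul_assoc, mul_vecMulVec, trace_vecMulVec, dotProduct_comm]

theorem dotProduct_mul_vecMulVec_mul_mulVec (X Z : Matrix ι ι ℝ) (y : ι → ℝ) :
    y ⬝ᵥ (X * vecMulVec y y * Z) *ᵥ y = (y ⬝ᵥ X *ᵥ y) * (y ⬝ᵥ Z *ᵥ y) := by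
  rw [← mulVec_mulVec, ← mulVec_mulVec, vecMulVec_mulVec, mulVec_smul, dotProduct_smul]
  simp

theorem posSemidef_vecMulVec_self (y : ι → ℝ) : (vecMulVec y y).PosSemidef := by
  simpa using posSemidef_vecMulVec_self_star y

variable [DecidableEq ι]

/-- Simultaneous diagonalization of all powers of all resolvents of a positive semidefinite
matrix. -/
theorem exists_diagonalization_resolvent {B : Matrix ι ι ℝ} (hB : B.PosSemidef) :
    ∃ (b : ι → ℝ) (V : Matrix ι ι ℝ), (∀ i, 0 ≤ b i) ∧ Vᵀ * V = 1 ∧ V * Vᵀ = 1 ∧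
      B = V * diagonal b * Vᵀ ∧
      ∀ s : ℝ, 0 < s → (B + s • 1) * (B + s • 1)⁻¹ = 1 ∧ ∀ q : ℕ,
        ((B + s • 1)⁻¹) ^ q = V * diagonal (fun i => ((b i + s)⁻¹) ^ q) * Vᵀ := by
  set V : Matrix ι ι ℝ := (hB.1.eigenvectorUnitary : Matrix ι ι ℝ) with hV
  have h1 : Vᵀ * V = 1 := by
    have := Unitary.coe_star_mul_self hB.1.eigenvectorUnitary
    simpa [star_eq_conjTranspose] using this
  have h2 : V * Vᵀ = 1 := mul_eq_one_comm.mp h1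
  have hb : B = V * diagonal hB.1.eigenvalues * Vᵀ := by
    have := hB.1.spectral_theorem
    rw [Unitary.conjStarAlgAut_apply] at this
    simpa [star_eq_conjTranspose, hV, Function.comp_def] using this
  refine ⟨hB.1.eigenvalues, V, hB.eigenvalues_nonneg, h1, h2, hb, fun s hs => ?_⟩
  have hpos : ∀ i, 0 < hB.1.eigenvalues i + s := fun i => by
    have := hB.eigenvalues_nonneg i
    linarith
  have hBs : B + s • 1 = V * diagonal (fun i => hB.1.eigenvalues i + s) * Vᵀ := by
    conv_lhs => rw [hb]
    rw [← diagonal_add, Matrix.mul_add, Matrix.add_mul]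
    congr 1
    have : diagonal (fun _ : ι => s) = s • (1 : Matrix ι ι ℝ) := by
      rw [smul_one_eq_diagonal]
    rw [this]
    simp [h2]
  have hmul : ∀ d e : ι → ℝ, (V * diagonal d * Vᵀ) * (V * diagonal e * Vᵀ) =
      V * diagonal (fun i => d i * e i) * Vᵀ := fun d e => by
    rw [← diagonal_mul_diagonal]
    calc _ = V * diagonal d * (Vᵀ * V) * diagonal e * Vᵀ := by simp only [Matrix.mul_assoc]
      _ = _ := by rw [h1]; simp only [Matrix.mul_assoc, Matrix.one_mul]
  have hone : (B + s • 1) * (V * diagonal (fun i => (hB.1.eigenvalues i + s)⁻¹) * Vᵀ) = 1 := by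
    rw [hBs, hmul]
    have : (fun i => (hB.1.eigenvalues i + s) * (hB.1.eigenvalues i + s)⁻¹) = fun _ => 1 := by
      funext i
      exact mul_inv_cancel₀ (hpos i).ne'
    rw [this, diagonal_one, Matrix.mul_one, h2]
  have hinv := inv_eq_right_inv hone
  refine ⟨by rw [hinv, hone], fun q => ?_⟩
  rw [hinv]
  induction q with
  | zero => simp [h2]
  | succ q ih => rw [pow_succ, ih, hmul]; simp only [pow_succ]

theorem dotProduct_conj_diagonal_mulVec (V : Matrix ι ι ℝ) (d x : ι → ℝ) :
    x ⬝ᵥ (V * diagonal d * Vᵀ) *ᵥ x = ∑ i, (Vᵀ *ᵥ x) i ^ 2 * d i := by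
  rw [← mulVec_mulVec, ← mulVec_mulVec, dotProduct_mulVec, ← mulVec_transpose]
  simp only [dotProduct, mulVec_diagonal]
  exact Finset.sum_congr rfl fun i _ => by ring

theorem trace_conj_diagonal {V : Matrix ι ι ℝ} (hV : Vᵀ * V = 1) (d : ι → ℝ) :
    (V * diagonal d * Vᵀ).trace = ∑ i, d i := by
  rw [trace_mul_comm, ← Matrix.mul_assoc, hV, Matrix.one_mul, trace_diagonal]

/-- The moments of a resolvent with respect to a vector are the moments of a positive measure. -/
theorem exists_moments_resolvent {B : Matrix ι ι ℝ} (hB : B.PosSemidef) {s : ℝ} (hs : 0 < s)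
    (y : ι → ℝ) :
    ∃ a r : ι → ℝ, (∀ i, 0 ≤ a i) ∧ (∀ i, 0 ≤ r i) ∧ (∀ i, r i ≤ s⁻¹) ∧ ∑ i, a i = y ⬝ᵥ y ∧
      ∀ q : ℕ, y ⬝ᵥ (((B + s • 1)⁻¹) ^ q) *ᵥ y = ∑ i, a i * r i ^ q := by
  obtain ⟨b, V, hb, h1, h2, -, h⟩ := exists_diagonalization_resolvent hB
  have hm : ∀ q : ℕ, y ⬝ᵥ (((B + s • 1)⁻¹) ^ q) *ᵥ y =
      ∑ i, (Vᵀ *ᵥ y) i ^ 2 * ((b i + s)⁻¹) ^ q := fun q => by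
    rw [(h s hs).2 q, dotProduct_conj_diagonal_mulVec]
  refine ⟨fun i => (Vᵀ *ᵥ y) i ^ 2, fun i => (b i + s)⁻¹, fun i => sq_nonneg _, fun i => ?_,
    fun i => ?_, ?_, hm⟩
  · have := hb i
    positivity
  · have := hb i
    exact inv_anti₀ hs (by linarith)
  · simpa using (hm 0).symm

/-- Telescoping of the resolvent identity; the exponents in each term add up to `q + 1`. -/
theorem pow_sub_pow_eq_sum_of_sub_eq {X Y E : Matrix ι ι ℝ} (h : X - Y = X * E * Y) (q : ℕ) :
    X ^ q - Y ^ q = ∑ j ∈ Finset.range q, X ^ (j + 1) * E * Y ^ (q - j) := by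
  induction q with
  | zero => simp
  | succ q ih =>
    have : X ^ (q + 1) - Y ^ (q + 1) = (X ^ q - Y ^ q) * Y + X ^ q * (X - Y) := by
      rw [pow_succ, pow_succ]
      noncomm_ring
    rw [this, ih, h, Finset.sum_range_succ, Finset.sum_mul]
    congr 1
    · refine Finset.sum_congr rfl fun j hj => ?_
      have hj' : q + 1 - j = (q - j) + 1 := by
        have := Finset.mem_range.1 hj
        omega
      rw [hj', pow_succ Y, Matrix.mul_assoc (X ^ (j + 1) * E)]
    · simp [pow_succ, Matrix.mul_assoc]

/-- `tr (M⁻¹) ^ p`, a smooth substitute for `‖M⁻¹‖ ^ p`. -/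
noncomputable def resolventTrace (p : ℕ) (M : Matrix ι ι ℝ) : ℝ := ((M⁻¹) ^ p).trace

/-- Effect of a rank-one update on `resolventTrace`. -/
theorem resolventTrace_add_vecMulVec_le {B : Matrix ι ι ℝ} (hB : B.PosSemidef) {s ε : ℝ}
    (hs : 0 < s) (y : ι → ℝ) (p : ℕ) (hy : p * (y ⬝ᵥ y) ≤ ε * s) :
    resolventTrace p (B + vecMulVec y y + s • 1) ≤ resolventTrace p (B + s • 1) -
      p * (1 - ε) * (y ⬝ᵥ (((B + s • 1)⁻¹) ^ (p + 1)) *ᵥ y) := by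
  have hB' : (B + vecMulVec y y).PosSemidef := hB.add (posSemidef_vecMulVec_self y)
  obtain ⟨a, r, ha, hr, hrs, hsum, hg⟩ := exists_moments_resolvent hB hs y
  obtain ⟨a', r', ha', hr', -, -, hh⟩ := exists_moments_resolvent hB' hs y
  obtain ⟨_, _, -, -, -, -, hinv⟩ := exists_diagonalization_resolvent hB
  obtain ⟨_, _, -, -, -, -, hinv'⟩ := exists_diagonalization_resolvent hB'
  have hM := (hinv s hs).1
  have hN := (hinv' s hs).1
  unfold resolventTrace
  set M := B + s • (1 : Matrix ι ι ℝ) with hMd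
  set Y := B + vecMulVec y y + s • (1 : Matrix ι ι ℝ) with hYd
  set R := M⁻¹ with hR
  set S := Y⁻¹ with hS
  have hYM : Y = M + vecMulVec y y := by rw [hYd, hMd]; abel
  have hM' : R * M = 1 := mul_eq_one_comm.mp hM
  have hN' : S * Y = 1 := mul_eq_one_comm.mp hN
  have hRS : R - S = R * vecMulVec y y * S := by
    have : vecMulVec y y = Y - M := by rw [hYM]; abel
    rw [this, Matrix.mul_sub, Matrix.sub_mul, Matrix.mul_assoc, hN, hM', Matrix.mul_one,
      Matrix.one_mul]
  have hSR : R - S = S * vecMulVec y y * R := by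
    have : vecMulVec y y = Y - M := by rw [hYM]; abel
    rw [this, Matrix.mul_sub, Matrix.sub_mul, Matrix.mul_assoc S M, hM, hN', Matrix.mul_one,
      Matrix.one_mul]
  set g : ℕ → ℝ := fun q => y ⬝ᵥ (R ^ q) *ᵥ y with hgd
  set h : ℕ → ℝ := fun q => y ⬝ᵥ (S ^ q) *ᵥ y with hhd
  have hg0 : ∀ q, 0 ≤ g q := fun q => by
    rw [hgd]; simp only [hg]
    exact Finset.sum_nonneg fun i _ => mul_nonneg (ha i) (pow_nonneg (hr i) _)
  have hh0 : ∀ q, 0 ≤ h q := fun q => by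
    rw [hhd]; simp only [hh]
    exact Finset.sum_nonneg fun i _ => mul_nonneg (ha' i) (pow_nonneg (hr' i) _)
  have hgg : ∀ m n, g (m + 1) * g (n + 1) ≤ g 1 * g (m + n + 1) := fun m n => by
    rw [hgd]; simp only [hg]
    exact sum_mul_pow_mul_sum_mul_pow_le ha hr m n
  -- The eigenvalues of the resolvent are at most `s⁻¹`, so the assumption on `y` makes `p * g 1`
  -- small.
  have hg1 : p * g 1 ≤ ε := by
    have : g 1 ≤ (y ⬝ᵥ y) * s⁻¹ := by
      rw [hgd]; simp only [hg]
      rw [← hsum, Finset.sum_mul]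
      exact Finset.sum_le_sum fun i _ => by
        rw [pow_one]; exact mul_le_mul_of_nonneg_left (hrs i) (ha i)
    calc p * g 1 ≤ p * ((y ⬝ᵥ y) * s⁻¹) := by gcongr
      _ = p * (y ⬝ᵥ y) * s⁻¹ := by ring
      _ ≤ ε * s * s⁻¹ := by gcongr
      _ = ε := mul_inv_cancel_right₀ hs.ne' ε
  have hmix : ∀ l k : ℕ, y ⬝ᵥ (R ^ l * S ^ k) *ᵥ y =
      g (l + k) - ∑ j ∈ Finset.range k, g (l + j + 1) * h (k - j) := fun l k => by
    have e1 := pow_sub_pow_eq_sum_of_sub_eq hRS k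
    have e2 : R ^ l * S ^ k =
        R ^ (l + k) - ∑ j ∈ Finset.range k, R ^ (l + j + 1) * vecMulVec y y * S ^ (k - j) := by
      have : S ^ k = R ^ k - (R ^ k - S ^ k) := by abel
      rw [this, e1, Matrix.mul_sub, ← pow_add, Finset.mul_sum]
      congr 1
      refine Finset.sum_congr rfl fun j _ => ?_
      rw [add_assoc l, pow_add R l]
      simp only [Matrix.mul_assoc]
    rw [e2, sub_mulVec, dotProduct_sub, sum_mulVec, dotProduct_sum]
    simp only [dotProduct_mul_vecMulVec_mul_mulVec, hgd, hhd]
  have hhg : ∀ k, h k ≤ g k := fun k => by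
    have := hmix 0 k
    simp only [pow_zero, Matrix.one_mul, zero_add] at this
    have h2 : 0 ≤ ∑ j ∈ Finset.range k, g (j + 1) * h (k - j) :=
      Finset.sum_nonneg fun j _ => mul_nonneg (hg0 _) (hh0 _)
    change y ⬝ᵥ (S ^ k) *ᵥ y ≤ _
    rw [this]
    linarith
  -- Replacing up to `p` factors `R` by `S` costs at most `ε * g (p + 1)`: there are `k ≤ p`
  -- correction terms, each at most `g 1 * g (p + 1)` by the association inequality.
  have hmix' : ∀ l k : ℕ, k ≤ p → l + k = p + 1 →
      (1 - ε) * g (p + 1) ≤ y ⬝ᵥ (R ^ l * S ^ k) *ᵥ y := fun l k hk hlk => by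
    have h1 : ∑ j ∈ Finset.range k, g (l + j + 1) * h (k - j) ≤
        ∑ _j ∈ Finset.range k, g 1 * g (p + 1) := by
      refine Finset.sum_le_sum fun j hj => ?_
      have hjk := Finset.mem_range.1 hj
      refine (mul_le_mul_of_nonneg_left (hhg _) (hg0 _)).trans ?_
      have e1 : k - j = (k - j - 1) + 1 := by omega
      have e2 : p + 1 = (l + j) + (k - j - 1) + 1 := by omega
      rw [e2, e1]
      exact hgg _ _
    rw [Finset.sum_const, Finset.card_range, nsmul_eq_mul] at h1
    have h2 : (k : ℝ) * (g 1 * g (p + 1)) ≤ ε * g (p + 1) := by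
      rw [← mul_assoc]
      refine mul_le_mul_of_nonneg_right (le_trans ?_ hg1) (hg0 _)
      exact mul_le_mul_of_nonneg_right (by exact_mod_cast hk) (hg0 _)
    rw [hmix, hlk]
    linarith
  -- By cyclicity of the trace, the decrease is a sum of `p` mixed moments, each of total degree `p
  -- + 1`.
  have htr : (R ^ p).trace - (S ^ p).trace =
      ∑ j ∈ Finset.range p, y ⬝ᵥ (R ^ (p - j) * S ^ (j + 1)) *ᵥ y := by
    have hSR' : S - R = S * (-vecMulVec y y) * R := by
      rw [Matrix.mul_neg, Matrix.neg_mul, ← hSR]; abel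
    have e1 := pow_sub_pow_eq_sum_of_sub_eq hSR' p
    have e2 : R ^ p - S ^ p =
        ∑ j ∈ Finset.range p, S ^ (j + 1) * vecMulVec y y * R ^ (p - j) := by
      rw [← neg_sub, e1, ← Finset.sum_neg_distrib]
      exact Finset.sum_congr rfl fun j _ => by
        rw [Matrix.mul_neg, Matrix.neg_mul, neg_neg]
    rw [← trace_sub, e2, trace_sum]
    exact Finset.sum_congr rfl fun j _ => mul_vecMulVec_mul_eq _ _ _
  have hle : (p : ℝ) * ((1 - ε) * g (p + 1)) ≤ (R ^ p).trace - (S ^ p).trace := by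
    rw [htr]
    have : ∑ _j ∈ Finset.range p, (1 - ε) * g (p + 1) = (p : ℝ) * ((1 - ε) * g (p + 1)) := by
      rw [Finset.sum_const, Finset.card_range, nsmul_eq_mul]
    rw [← this]
    refine Finset.sum_le_sum fun j hj => hmix' _ _ ?_ ?_
    · exact Finset.mem_range.1 hj
    · have := Finset.mem_range.1 hj
      omega
  change _ ≤ _ - p * (1 - ε) * g (p + 1)
  linarith

theorem resolventTrace_nonneg {B : Matrix ι ι ℝ} (hB : B.PosSemidef) {s : ℝ} (hs : 0 < s)
    (p : ℕ) : 0 ≤ resolventTrace p (B + s • 1) := by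
  obtain ⟨b, V, hb, h1, -, -, h⟩ := exists_diagonalization_resolvent hB
  rw [resolventTrace, (h s hs).2, trace_conj_diagonal h1]
  exact Finset.sum_nonneg fun i _ => pow_nonneg (inv_nonneg.2 (by linarith [hb i])) _

/-- Convexity of `resolventTrace` along multiples of the identity. -/
theorem resolventTrace_sub_le {B : Matrix ι ι ℝ} (hB : B.PosSemidef) {s c : ℝ} (hs : 0 < s)
    (hc : 0 ≤ c) (p : ℕ) :
    resolventTrace p (B + s • 1) - p * c * (((B + s • 1)⁻¹) ^ (p + 1)).trace ≤
      resolventTrace p (B + (s + c) • 1) := by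
  obtain ⟨b, V, hb, h1, -, -, h⟩ := exists_diagonalization_resolvent hB
  unfold resolventTrace
  rw [(h s hs).2, (h s hs).2, (h (s + c) (by linarith)).2, trace_conj_diagonal h1,
    trace_conj_diagonal h1, trace_conj_diagonal h1, Finset.mul_sum, ← Finset.sum_sub_distrib]
  refine Finset.sum_le_sum fun i _ => ?_
  have hx : 0 < b i + s := by linarith [hb i]
  set x := b i + s
  have hxc : b i + (s + c) = x * (1 + c / x) := by field_simp; ring
  have hcx : 0 ≤ c / x := by positivity
  -- Bernoulli's inequality for `(1 + z)⁻¹ = 1 - z / (1 + z)` with `z = c / x`.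
  have hber : 1 - p * (c / x) ≤ ((1 + c / x)⁻¹) ^ p := by
    have e : (1 + c / x)⁻¹ = 1 + -(c / x / (1 + c / x)) := by field_simp; ring
    have h2 : c / x / (1 + c / x) ≤ c / x := div_le_self hcx (by linarith)
    have h3 : (-2 : ℝ) ≤ -(c / x / (1 + c / x)) := by
      have : c / x / (1 + c / x) ≤ 1 := by
        rw [div_le_one (by positivity)]; linarith
      linarith
    rw [e]
    refine le_trans ?_ (one_add_mul_le_pow h3 p)
    have : (p : ℝ) * (c / x / (1 + c / x)) ≤ p * (c / x) := by gcongr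
    linarith
  rw [hxc, mul_inv, mul_pow]
  calc (x⁻¹) ^ p - p * c * (x⁻¹) ^ (p + 1) = (x⁻¹) ^ p * (1 - p * (c / x)) := by
        rw [pow_succ]; ring
    _ ≤ _ := mul_le_mul_of_nonneg_left hber (by positivity)

theorem resolventTrace_smul_one (p : ℕ) {s : ℝ} (hs : 0 < s) :
    resolventTrace p ((0 : Matrix ι ι ℝ) + s • 1) = Fintype.card ι * (s⁻¹) ^ p := by
  have h : ((0 : Matrix ι ι ℝ) + s • 1)⁻¹ = s⁻¹ • 1 := by
    refine inv_eq_right_inv ?_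
    simp [hs.ne']
  rw [resolventTrace, h, smul_pow, one_pow, trace_smul, trace_one, smul_eq_mul, mul_comm]

/-- A small `resolventTrace` bounds the spectrum from below. -/
theorem mul_dotProduct_le_of_resolventTrace_lt {B : Matrix ι ι ℝ} (hB : B.PosSemidef) {s τ : ℝ}
    (hs : 0 < s) (hτ : 0 < τ) {p : ℕ} (h : resolventTrace p (B + s • 1) < (τ⁻¹) ^ p)
    (x : ι → ℝ) : (τ - s) * (x ⬝ᵥ x) ≤ x ⬝ᵥ B *ᵥ x := by
  obtain ⟨b, V, hb, h1, h2, hBe, h'⟩ := exists_diagonalization_resolvent hB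
  rw [resolventTrace, (h' s hs).2, trace_conj_diagonal h1] at h
  have hbi : ∀ i, τ - s ≤ b i := fun i => by
    -- A single eigenvalue below `τ - s` would already contribute at least `(τ⁻¹) ^ p` to the trace.
    by_contra! hlt
    have hpos : 0 < b i + s := by linarith [hb i]
    have : (τ⁻¹) ^ p ≤ ((b i + s)⁻¹) ^ p :=
      pow_le_pow_left₀ (by positivity) (inv_anti₀ hpos (by linarith)) p
    have h3 : ((b i + s)⁻¹) ^ p ≤ ∑ i, ((b i + s)⁻¹) ^ p :=
      Finset.single_le_sum (f := fun i => ((b i + s)⁻¹) ^ p)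
        (fun j _ => pow_nonneg (inv_nonneg.2 (by linarith [hb j])) _) (Finset.mem_univ i)
    linarith
  have hx : x ⬝ᵥ x = ∑ i, (Vᵀ *ᵥ x) i ^ 2 := by
    have := dotProduct_conj_diagonal_mulVec V (fun _ => 1) x
    simpa [h2] using this
  rw [hBe, dotProduct_conj_diagonal_mulVec, hx, Finset.mul_sum]
  exact Finset.sum_le_sum fun i _ => by
    rw [mul_comm]; exact mul_le_mul_of_nonneg_left (hbi i) (sq_nonneg _)

end ResolventTrace

/-! ### Lower spectral tail for sums of independent isotropic rank-one matrices. -/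

section LowerTail

variable {ι : Type*} [Fintype ι]

theorem dotProduct_mulVec_eq_sum (A : Matrix ι ι ℝ) (v : ι → ℝ) :
    v ⬝ᵥ A *ᵥ v = ∑ k, ∑ l, A k l * (v k * v l) := by
  simp only [dotProduct, mulVec, Finset.mul_sum]
  exact Finset.sum_congr rfl fun k _ => Finset.sum_congr rfl fun l _ => by ring

variable [DecidableEq ι] {X : Type*} [MeasurableSpace X]

/-- The inverse is the inverted determinant times the adjugate, both measurable in the entries; at
singular matrices the convention `0⁻¹ = 0` keeps the formula valid. -/
theorem measurable_resolventTrace (p : ℕ) {f : X → Matrix ι ι ℝ}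
    (hf : ∀ i j, Measurable fun x => f x i j) : Measurable fun x => resolventTrace p (f x) := by
  have hof : Continuous fun a : ι → ι → ℝ => Matrix.of a :=
    continuous_matrix fun i j => (continuous_apply j).comp (continuous_apply i)
  have hF : Measurable fun a : ι → ι → ℝ =>
      ((Matrix.det (Matrix.of a))⁻¹) ^ p * (((Matrix.of a).adjugate) ^ p).trace :=
    (hof.matrix_det.measurable.inv.pow_const p).mul
      (hof.matrix_adjugate.pow p).matrix_trace.measurable
  have hf' : Measurable fun x => (fun i j => f x i j : ι → ι → ℝ) :=
    measurable_pi_lambda _ fun i => measurable_pi_lambda _ fun j => hf i j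
  have he : (fun x => resolventTrace p (f x)) = fun x =>
      ((Matrix.det (Matrix.of (fun i j => f x i j)))⁻¹) ^ p *
        (((Matrix.of (fun i j => f x i j)).adjugate) ^ p).trace := by
    funext x
    change ((f x)⁻¹ ^ p).trace = ((f x).det)⁻¹ ^ p * ((f x).adjugate ^ p).trace
    rw [inv_def, Ring.inverse_eq_inv', smul_pow, trace_smul, smul_eq_mul]
  rw [he]
  exact hF.comp hf'

/-- Isotropic random vectors whose squared norm is bounded by `μ`. -/
structure IsIsotropicBounded (g : Measure X) (y : X → ι → ℝ) (μ : ℝ) : Prop where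
  measurable : ∀ k, Measurable fun x => y x k
  bound : ∀ᵐ x ∂g, y x ⬝ᵥ y x ≤ μ
  isotropic : ∀ k l, ∫ x, y x k * y x l ∂g = if k = l then 1 else 0

namespace IsIsotropicBounded

variable {g : Measure X} {y : X → ι → ℝ} {μ : ℝ}

theorem bound_pos [Nonempty ι] (h : IsIsotropicBounded g y μ) : 0 < μ := by
  by_contra! hμ
  obtain ⟨k⟩ := ‹Nonempty ι›
  have h0 : (fun x => y x k * y x k) =ᵐ[g] 0 := by
    filter_upwards [h.bound] with x hx
    have : y x k * y x k ≤ y x ⬝ᵥ y x :=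
      Finset.single_le_sum (f := fun i => y x i * y x i) (fun i _ => mul_self_nonneg _)
        (Finset.mem_univ k)
    exact le_antisymm (this.trans (hx.trans hμ)) (mul_self_nonneg _)
  have h1 := h.isotropic k k
  rw [integral_congr_ae h0] at h1
  simp at h1

variable [IsProbabilityMeasure g]

theorem integrable_mul (h : IsIsotropicBounded g y μ) (k l : ι) :
    Integrable (fun x => y x k * y x l) g := by
  refine Integrable.of_bound ((h.measurable k).mul (h.measurable l)).aestronglyMeasurable μ ?_
  filter_upwards [h.bound] with x hx
  have hk : ∀ k, y x k ^ 2 ≤ μ := fun k => by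
    refine le_trans ?_ hx
    rw [dotProduct, pow_two]
    exact Finset.single_le_sum (f := fun i => y x i * y x i) (fun i _ => mul_self_nonneg _)
      (Finset.mem_univ k)
  rw [Real.norm_eq_abs, abs_le]
  constructor <;> nlinarith [hk k, hk l, sq_nonneg (y x k + y x l), sq_nonneg (y x k - y x l)]

theorem integrable_quadratic (h : IsIsotropicBounded g y μ) (A : Matrix ι ι ℝ) :
    Integrable (fun x => y x ⬝ᵥ A *ᵥ y x) g := by
  simp only [dotProduct_mulVec_eq_sum]
  exact integrable_finsetSum _ fun k _ => integrable_finsetSum _ fun l _ =>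
    (h.integrable_mul k l).const_mul _

theorem integral_quadratic (h : IsIsotropicBounded g y μ) (A : Matrix ι ι ℝ) :
    ∫ x, y x ⬝ᵥ A *ᵥ y x ∂g = A.trace := by
  simp only [dotProduct_mulVec_eq_sum]
  rw [integral_finsetSum _ fun k _ => integrable_finsetSum _ fun l _ =>
    (h.integrable_mul k l).const_mul (A k l)]
  refine Finset.sum_congr rfl fun k _ => ?_
  rw [integral_finsetSum _ fun l _ => (h.integrable_mul k l).const_mul (A k l)]
  simp [integral_const_mul, h.isotropic]

/-- Isotropy turns the mean of the quadratic form in the rank-one estimate into the trace of the `(p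
+ 1)`-st resolvent power. This is the first-order effect of the shift by `1 - ε`, and convexity
bounds it by the true effect. -/
theorem lintegral_resolventTrace_add_le (h : IsIsotropicBounded g y μ) {B : Matrix ι ι ℝ}
    (hB : B.PosSemidef) {s ε : ℝ} (hs : 0 < s) (hε : ε ≤ 1) {p : ℕ} (hp : p * μ ≤ ε * s) :
    ∫⁻ x, ENNReal.ofReal (resolventTrace p (B + vecMulVec (y x) (y x) + s • 1)) ∂g ≤
      ENNReal.ofReal (resolventTrace p (B + (s + (1 - ε)) • 1)) := by
  set R := (B + s • (1 : Matrix ι ι ℝ))⁻¹ with hR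
  set G : X → ℝ := fun x => resolventTrace p (B + s • 1) -
      p * (1 - ε) * (y x ⬝ᵥ (R ^ (p + 1)) *ᵥ y x) with hG
  have hle : ∀ᵐ x ∂g, resolventTrace p (B + vecMulVec (y x) (y x) + s • 1) ≤ G x := by
    filter_upwards [h.bound] with x hx
    refine resolventTrace_add_vecMulVec_le hB hs (y x) p (le_trans ?_ hp)
    gcongr
  have hG0 : 0 ≤ᵐ[g] G := by
    filter_upwards [hle] with x hx
    exact (resolventTrace_nonneg (hB.add (posSemidef_vecMulVec_self (y x))) hs p).trans hx
  have hGi : Integrable G g :=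
    (integrable_const _).sub ((h.integrable_quadratic _).const_mul _)
  calc _ ≤ ∫⁻ x, ENNReal.ofReal (G x) ∂g :=
        lintegral_mono_ae (hle.mono fun x hx => ENNReal.ofReal_le_ofReal hx)
    _ = ENNReal.ofReal (∫ x, G x ∂g) := (ofReal_integral_eq_lintegral_ofReal hGi hG0).symm
    _ ≤ _ := by
      refine ENNReal.ofReal_le_ofReal ?_
      rw [hG, integral_sub (integrable_const _) ((h.integrable_quadratic _).const_mul _),
        integral_const_mul, h.integral_quadratic]
      simp only [integral_const, probReal_univ, one_smul]
      exact resolventTrace_sub_le hB hs (by linarith) p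

/-- The first sample is frozen into `B` while the others are integrated. The shift gained from them
only increases `s`, so `p * μ ≤ ε * s` persists when the first sample is integrated in turn. -/
theorem lintegral_pi_resolventTrace_le (h : IsIsotropicBounded g y μ) {s ε : ℝ} (hs : 0 < s)
    (hε : ε ≤ 1) {p : ℕ} (hp : p * μ ≤ ε * s) (hε0 : 0 ≤ ε) (m : ℕ) :
    ∀ B : Matrix ι ι ℝ, B.PosSemidef →
    ∫⁻ ξ : Fin m → X, ENNReal.ofReal (resolventTrace p
        (B + ∑ i, vecMulVec (y (ξ i)) (y (ξ i)) + s • 1)) ∂(Measure.pi fun _ => g) ≤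
      ENNReal.ofReal (resolventTrace p (B + (s + m * (1 - ε)) • 1)) := by
  induction m with
  | zero =>
    intro B hB
    simp
  | succ m ih =>
    intro B hB
    have hmp := measurePreserving_piFinSuccAbove (fun _ : Fin (m + 1) => g) 0
    have hm : Measurable fun z : X × (Fin m → X) => ENNReal.ofReal (resolventTrace p
        (B + vecMulVec (y z.1) (y z.1) + ∑ i, vecMulVec (y (z.2 i)) (y (z.2 i)) + s • 1)) := by
      refine (measurable_resolventTrace p fun i j => ?_).ennreal_ofReal
      simp only [Matrix.add_apply, Matrix.sum_apply, vecMulVec_apply]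
      refine Measurable.add (Measurable.add (measurable_const.add ?_) ?_) measurable_const
      · exact ((h.measurable i).comp measurable_fst).mul ((h.measurable j).comp measurable_fst)
      · refine Finset.measurable_sum _ fun k _ => ?_
        exact ((h.measurable i).comp ((measurable_pi_apply k).comp measurable_snd)).mul
          ((h.measurable j).comp ((measurable_pi_apply k).comp measurable_snd))
    have e1 := hmp.lintegral_comp hm
    have e2 : ∀ ξ : Fin (m + 1) → X, B + ∑ i, vecMulVec (y (ξ i)) (y (ξ i)) =
        B + vecMulVec (y (ξ 0)) (y (ξ 0)) +
          ∑ i : Fin m, vecMulVec (y (ξ i.succ)) (y (ξ i.succ)) := fun ξ => by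
      rw [Fin.sum_univ_succ, add_assoc]
    simp only [e2]
    refine (le_of_eq e1).trans ?_
    rw [lintegral_prod _ hm.aemeasurable]
    refine (lintegral_mono fun x =>
      ih (B + vecMulVec (y x) (y x)) (hB.add (posSemidef_vecMulVec_self (y x)))).trans ?_
    have hs' : 0 ≤ (m : ℝ) * (1 - ε) := mul_nonneg m.cast_nonneg (by linarith)
    refine (h.lintegral_resolventTrace_add_le hB (by linarith) hε (p := p) ?_).trans
      (le_of_eq ?_)
    · nlinarith
    · push_cast
      ring_nf

/-- Lower tail bound for sums of independent isotropic rank-one matrices. -/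
theorem measure_pi_le (h : IsIsotropicBounded g y μ) {s ε τ : ℝ} (hs : 0 < s)
    (hε : ε ≤ 1) {p : ℕ} (hp : p * μ ≤ ε * s) (hε0 : 0 ≤ ε) (hτ : 0 < τ)
    (m : ℕ) :
    (Measure.pi fun _ : Fin m => g) {ξ | ¬ ∀ x : ι → ℝ, (τ * (s + m * (1 - ε)) - s) * (x ⬝ᵥ x) ≤
        x ⬝ᵥ (∑ i, vecMulVec (y (ξ i)) (y (ξ i))) *ᵥ x} ≤
      ENNReal.ofReal (Fintype.card ι * τ ^ p) := by
  set σ := s + m * (1 - ε) with hσ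
  have hσ0 : 0 < σ := by
    have : 0 ≤ (m : ℝ) * (1 - ε) := mul_nonneg m.cast_nonneg (by linarith)
    linarith
  have hS : ∀ ξ : Fin m → X, (∑ i, vecMulVec (y (ξ i)) (y (ξ i))).PosSemidef := fun ξ =>
    posSemidef_sum _ fun i _ => posSemidef_vecMulVec_self _
  -- Markov threshold: dividing the mean bound `card ι * (σ⁻¹) ^ p` by `a` leaves `card ι * τ ^ p`.
  set a : ℝ := ((τ * σ)⁻¹) ^ p with ha
  have ha0 : 0 < a := by positivity
  have hE := h.lintegral_pi_resolventTrace_le hs hε hp hε0 m 0 PosSemidef.zero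
  rw [resolventTrace_smul_one p hσ0] at hE
  have hmeas : Measurable fun ξ : Fin m → X => ENNReal.ofReal (resolventTrace p
        (0 + ∑ i, vecMulVec (y (ξ i)) (y (ξ i)) + s • 1)) := by
    refine (measurable_resolventTrace p fun i j => ?_).ennreal_ofReal
    simp only [Matrix.add_apply, Matrix.sum_apply, vecMulVec_apply]
    refine Measurable.add (measurable_const.add ?_) measurable_const
    refine Finset.measurable_sum _ fun k _ => ?_
    exact ((h.measurable i).comp (measurable_pi_apply k)).mul
      ((h.measurable j).comp (measurable_pi_apply k))
  have hsub : {ξ : Fin m → X | ¬ ∀ x : ι → ℝ, (τ * σ - s) * (x ⬝ᵥ x) ≤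
        x ⬝ᵥ (∑ i, vecMulVec (y (ξ i)) (y (ξ i))) *ᵥ x} ⊆
      {ξ | ENNReal.ofReal a ≤ ENNReal.ofReal (resolventTrace p
        (0 + ∑ i, vecMulVec (y (ξ i)) (y (ξ i)) + s • 1))} := by
    intro ξ hξ
    by_contra hlt
    refine hξ fun x => mul_dotProduct_le_of_resolventTrace_lt (p := p) (hS ξ) hs (by positivity) ?_ x
    simp only [Set.mem_ofPred_eq, not_le, zero_add] at hlt
    exact (ENNReal.ofReal_lt_ofReal_iff ha0).1 hlt
  refine (measure_mono hsub).trans ?_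
  refine (meas_ge_le_lintegral_div hmeas.aemeasurable (by simpa using ha0)
    ENNReal.ofReal_ne_top).trans ?_
  refine (ENNReal.div_le_div_right hE _).trans ?_
  rw [← ENNReal.ofReal_div_of_pos ha0]
  refine ENNReal.ofReal_le_ofReal (le_of_eq ?_)
  rw [ha, mul_inv, mul_pow]
  have : (σ⁻¹) ^ p ≠ 0 := by positivity
  have h2 : τ ^ p ≠ 0 := by positivity
  rw [inv_pow τ]
  field_simp

end IsIsotropicBounded
end LowerTail

/-! ### Orthonormality of the tensorized basis and Parseval's identity. -/

section Basis

variable {d : ℕ} {ν : Fin d → Measure ℝ} {P : Fin d → ℕ → Polynomial ℝ}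
  {B : Finset (Fin d → ℕ)} {r : Fin d → ℕ}

theorem continuous_pcBasis (P : Fin d → ℕ → Polynomial ℝ) (k : Fin d → ℕ) :
    Continuous (pcBasis P k) :=
  continuous_finsetProd _ fun i _ => (P i (k i)).continuous.comp (continuous_apply i)

/-- The integral of a nonintegrable function is `0` by convention, so the normalization to `1`
already contains square-integrability. -/
theorem IsOrthonormalUpTo.memLp {ν : Measure ℝ} {P : ℕ → Polynomial ℝ} {r : ℕ}
    (h : IsOrthonormalUpTo ν P r) {n : ℕ} (hn : n ≤ r) : MemLp (fun x => (P n).eval x) 2 ν := by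
  refine (memLp_two_iff_integrable_sq (P n).continuous.aestronglyMeasurable).2 ?_
  refine Integrable.of_integral_ne_zero ?_
  have := h.2 n hn n hn
  simp only [pow_two, this]
  simp

theorem integrable_pcBasis_mul [∀ i, IsProbabilityMeasure (ν i)]
    (hP : ∀ i, IsOrthonormalUpTo (ν i) (P i) (r i)) {k l : Fin d → ℕ} (hk : ∀ i, k i ≤ r i)
    (hl : ∀ i, l i ≤ r i) :
    Integrable (fun x => pcBasis P k x * pcBasis P l x) (Measure.pi ν) := by
  simp only [pcBasis, ← Finset.prod_mul_distrib]
  exact Integrable.fintype_prod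
    (f := fun i (x : ℝ) => (P i (k i)).eval x * (P i (l i)).eval x) fun i =>
    ((hP i).memLp (hk i)).integrable_mul ((hP i).memLp (hl i))

theorem integral_pcBasis_mul [∀ i, IsProbabilityMeasure (ν i)]
    (hP : ∀ i, IsOrthonormalUpTo (ν i) (P i) (r i)) {k l : Fin d → ℕ} (hk : ∀ i, k i ≤ r i)
    (hl : ∀ i, l i ≤ r i) :
    ∫ x, pcBasis P k x * pcBasis P l x ∂(Measure.pi ν) = if k = l then 1 else 0 := by
  simp only [pcBasis, ← Finset.prod_mul_distrib]
  rw [integral_fintype_prod_eq_prod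
    (f := fun i (x : ℝ) => (P i (k i)).eval x * (P i (l i)).eval x)]
  simp only [fun i => (hP i).2 (k i) (hk i) (l i) (hl i)]
  split_ifs with h
  · simp [h]
  · obtain ⟨i, hi⟩ := Function.ne_iff.1 h
    exact Finset.prod_eq_zero (Finset.mem_univ i) (if_neg hi)

theorem memLp_surrogate [∀ i, IsProbabilityMeasure (ν i)]
    (hP : ∀ i, IsOrthonormalUpTo (ν i) (P i) (r i)) (hB : ∀ k ∈ B, ∀ i, k i ≤ r i) (c : B → ℝ) :
    MemLp (surrogate P B c) 2 (Measure.pi ν) := by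
  refine memLp_finsetSum _ fun k _ => MemLp.const_mul ?_ (c k)
  refine (memLp_two_iff_integrable_sq (continuous_pcBasis P k).aestronglyMeasurable).2 ?_
  simp only [pow_two]
  exact integrable_pcBasis_mul hP (hB k k.2) (hB k k.2)

theorem integral_surrogate_sq [∀ i, IsProbabilityMeasure (ν i)]
    (hP : ∀ i, IsOrthonormalUpTo (ν i) (P i) (r i)) (hB : ∀ k ∈ B, ∀ i, k i ≤ r i) (c : B → ℝ) :
    ∫ x, surrogate P B c x ^ 2 ∂(Measure.pi ν) = c ⬝ᵥ c := by
  have h1 : ∀ x, surrogate P B c x ^ 2 =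
      ∑ k : B, ∑ l : B, c k * c l * (pcBasis P k x * pcBasis P l x) := fun x => by
    rw [pow_two, surrogate, Finset.sum_mul_sum]
    exact Finset.sum_congr rfl fun k _ => Finset.sum_congr rfl fun l _ => by ring
  have hi : ∀ k l : B, Integrable (fun x => c k * c l * (pcBasis P k x * pcBasis P l x))
      (Measure.pi ν) := fun k l =>
    (integrable_pcBasis_mul hP (hB k k.2) (hB l l.2)).const_mul _
  simp only [h1]
  rw [integral_finsetSum _ fun k _ => integrable_finsetSum _ fun l _ => hi k l]
  refine Finset.sum_congr rfl fun k _ => ?_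
  rw [integral_finsetSum _ fun l _ => hi k l]
  simp only [integral_const_mul, fun l : B => integral_pcBasis_mul hP (hB k k.2) (hB l l.2),
    Subtype.coe_inj]
  simp

theorem surrogate_sub (c c' : B → ℝ) (x : Fin d → ℝ) :
    surrogate P B (c - c') x = surrogate P B c x - surrogate P B c' x := by
  simp [surrogate, sub_mul, Finset.sum_sub_distrib]

end Basis

/-! ### Minkowski for RMSE, Euclidean norms and quadratic forms. -/

section Norms

theorem sqrt_integral_sq_eq {X : Type*} [MeasurableSpace X] {f : Measure X} {v : X → ℝ}
    (hv : MemLp v 2 f) : Real.sqrt (∫ x, v x ^ 2 ∂f) = (eLpNorm v 2 f).toReal := by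
  rw [hv.eLpNorm_eq_integral_rpow_norm (by norm_num) (by norm_num), ENNReal.toReal_ofReal
    (Real.rpow_nonneg (integral_nonneg fun x => Real.rpow_nonneg (norm_nonneg _) _) _),
    Real.sqrt_eq_rpow]
  simp

theorem rmse_le_add {X : Type*} [MeasurableSpace X] {f : Measure X} {u v v' : X → ℝ}
    (hu : MemLp u 2 f) (hv : MemLp v 2 f) (hv' : MemLp v' 2 f) :
    rmse f u v ≤ rmse f u v' + Real.sqrt (∫ x, (v x - v' x) ^ 2 ∂f) := by
  have h1 : MemLp (fun x => v x - u x) 2 f := hv.sub hu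
  have h2 : MemLp (fun x => v' x - u x) 2 f := hv'.sub hu
  have h3 : MemLp (fun x => v x - v' x) 2 f := hv.sub hv'
  rw [rmse, rmse, sqrt_integral_sq_eq h1, sqrt_integral_sq_eq h2, sqrt_integral_sq_eq h3,
    ← ENNReal.toReal_add h2.eLpNorm_ne_top h3.eLpNorm_ne_top]
  refine ENNReal.toReal_mono (ENNReal.add_ne_top.2 ⟨h2.eLpNorm_ne_top, h3.eLpNorm_ne_top⟩) ?_
  have e : (fun x => v x - u x) = (fun x => v' x - u x) + fun x => v x - v' x := by
    funext x
    simp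
  rw [e]
  exact eLpNorm_add_le h2.1 h3.1 (by norm_num)

variable {ι : Type*} [Fintype ι]

theorem l2norm_sq (v : ι → ℝ) : l2norm v ^ 2 = v ⬝ᵥ v := by
  rw [l2norm, EuclideanSpace.real_norm_sq_eq, dotProduct]
  exact Finset.sum_congr rfl fun i _ => pow_two _

theorem l2norm_nonneg (v : ι → ℝ) : 0 ≤ l2norm v := norm_nonneg _

theorem l2norm_sub_le (v w : ι → ℝ) : l2norm (v - w) ≤ l2norm v + l2norm w := by
  rw [l2norm, WithLp.toLp_sub]
  exact norm_sub_le _ _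

theorem dotProduct_mulVec_le_opNorm [DecidableEq ι] (A : Matrix ι ι ℝ) (x : ι → ℝ) :
    |x ⬝ᵥ A *ᵥ x| ≤ opNorm A * (x ⬝ᵥ x) := by
  have h : x ⬝ᵥ A *ᵥ x =
      inner ℝ (WithLp.toLp 2 x) (Matrix.toEuclideanCLM (𝕜 := ℝ) A (WithLp.toLp 2 x)) := by
    rw [Matrix.toEuclideanCLM_toLp, EuclideanSpace.inner_toLp_toLp, dotProduct_comm]
    simp
  rw [h, ← l2norm_sq]
  calc _ ≤ ‖WithLp.toLp 2 x‖ * ‖Matrix.toEuclideanCLM (𝕜 := ℝ) A (WithLp.toLp 2 x)‖ :=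
        abs_real_inner_le_norm _ _
    _ ≤ ‖WithLp.toLp 2 x‖ * (opNorm A * ‖WithLp.toLp 2 x‖) := by
        gcongr
        exact ContinuousLinearMap.le_opNorm _ _
    _ = _ := by rw [l2norm]; ring

end Norms

/-! ### Gram matrices of samples and the deterministic error bound. -/

section Design

variable {d N : ℕ} {P : Fin d → ℕ → Polynomial ℝ} {B : Finset (Fin d → ℕ)}
  {w : (Fin d → ℝ) → ℝ}

theorem designMatrix_apply (ξ : Fin N → Fin d → ℝ) (i : Fin N) (k : B) :
    designMatrix P B w ξ i k = w (ξ i) / Real.sqrt N * pcBasis P k (ξ i) := by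
  rw [designMatrix, weightMatrix, diagonal_mul, measurementMatrix, of_apply]

/-- The rows of the design matrix, up to normalization. -/
def weightedBasis (P : Fin d → ℕ → Polynomial ℝ) (B : Finset (Fin d → ℕ))
    (w : (Fin d → ℝ) → ℝ) (x : Fin d → ℝ) (k : B) : ℝ :=
  w x * pcBasis P k x

theorem transpose_designMatrix_mul_designMatrix (ξ : Fin N → Fin d → ℝ) :
    (designMatrix P B w ξ)ᵀ * designMatrix P B w ξ =
      (N : ℝ)⁻¹ • ∑ i, vecMulVec (weightedBasis P B w (ξ i)) (weightedBasis P B w (ξ i)) := by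
  ext k l
  rw [mul_apply, Matrix.smul_apply, Matrix.sum_apply, smul_eq_mul, Finset.mul_sum]
  refine Finset.sum_congr rfl fun i _ => ?_
  rw [transpose_apply, designMatrix_apply, designMatrix_apply, vecMulVec_apply, weightedBasis,
    weightedBasis]
  have h : (N : ℝ)⁻¹ = (Real.sqrt N)⁻¹ * (Real.sqrt N)⁻¹ := by
    rw [← mul_inv, Real.mul_self_sqrt N.cast_nonneg]
  rw [h, div_eq_mul_inv]
  ring

/-- The samples whose empirical Gram matrix is bounded below by `η`. -/
def gramLowerBound (N : ℕ) (P : Fin d → ℕ → Polynomial ℝ) (B : Finset (Fin d → ℕ))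
    (w : (Fin d → ℝ) → ℝ) (η : ℝ) : Set (Fin N → Fin d → ℝ) :=
  {ξ | ∀ x : B → ℝ, η * (x ⬝ᵥ x) ≤ x ⬝ᵥ ((designMatrix P B w ξ)ᵀ * designMatrix P B w ξ) *ᵥ x}

/-- The uncountably many conditions cut out a closed set in the matrix entries, whose preimage under
a measurable map is measurable. -/
theorem measurableSet_gramLowerBound (hw : Measurable w) (η : ℝ) :
    MeasurableSet (gramLowerBound N P B w η) := by
  have hcl : IsClosed {a : B → B → ℝ |
      ∀ x : B → ℝ, η * (x ⬝ᵥ x) ≤ ∑ k, ∑ l, a k l * (x k * x l)} := by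
    have : {a : B → B → ℝ | ∀ x : B → ℝ, η * (x ⬝ᵥ x) ≤ ∑ k, ∑ l, a k l * (x k * x l)} =
        ⋂ x : B → ℝ, {a | η * (x ⬝ᵥ x) ≤ ∑ k, ∑ l, a k l * (x k * x l)} := by
      ext a
      simp
    rw [this]
    refine isClosed_iInter fun x => isClosed_le continuous_const ?_
    fun_prop
  have hm : Measurable fun ξ : Fin N → Fin d → ℝ =>
      (fun k l => ((designMatrix P B w ξ)ᵀ * designMatrix P B w ξ) k l : B → B → ℝ) := by
    refine measurable_pi_lambda _ fun k => measurable_pi_lambda _ fun l => ?_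
    simp only [mul_apply, transpose_apply, designMatrix_apply]
    have hb : ∀ (i : Fin N) (k : B), Measurable fun ξ : Fin N → Fin d → ℝ =>
        w (ξ i) / Real.sqrt N * pcBasis P k (ξ i) := fun i k =>
      ((hw.comp (measurable_pi_apply i)).div_const _).mul
        ((continuous_pcBasis P k).measurable.comp (measurable_pi_apply i))
    exact Finset.measurable_sum _ fun i _ => (hb i k).mul (hb i l)
  have he : gramLowerBound N P B w η = (fun ξ : Fin N → Fin d → ℝ =>
      (fun k l => ((designMatrix P B w ξ)ᵀ * designMatrix P B w ξ) k l : B → B → ℝ)) ⁻¹'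
      {a | ∀ x : B → ℝ, η * (x ⬝ᵥ x) ≤ ∑ k, ∑ l, a k l * (x k * x l)} := by
    ext ξ
    simp only [gramLowerBound, dotProduct_mulVec_eq_sum]
    rfl
  rw [he]
  exact hm hcl.measurableSet

theorem residual_eq (ξ : Fin N → Fin d → ℝ) (u : (Fin d → ℝ) → ℝ) (c : B → ℝ) :
    residual P B w ξ u c = l2norm ((weightMatrix w ξ) *ᵥ (fun i => u (ξ i)) -
      designMatrix P B w ξ *ᵥ c) := by
  rw [residual, mulVec_sub, mulVec_mulVec, designMatrix]

/-- Two vectors feasible for the same tolerance are close in the Euclidean norm. -/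
theorem l2norm_sub_le_of_residual_le {η : ℝ} {ξ : Fin N → Fin d → ℝ}
    (hξ : ξ ∈ gramLowerBound N P B w (η ^ 2)) {u : (Fin d → ℝ) → ℝ} {c c' : B → ℝ} {T : ℝ}
    (hc : residual P B w ξ u c ≤ T) (hc' : residual P B w ξ u c' ≤ T) :
    η * l2norm (c - c') ≤ 2 * T := by
  rw [residual_eq] at hc hc'
  have h1 : l2norm (designMatrix P B w ξ *ᵥ (c - c')) ≤ 2 * T := by
    have e : designMatrix P B w ξ *ᵥ (c - c') =
        ((weightMatrix w ξ) *ᵥ (fun i => u (ξ i)) - designMatrix P B w ξ *ᵥ c') -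
        ((weightMatrix w ξ) *ᵥ (fun i => u (ξ i)) - designMatrix P B w ξ *ᵥ c) := by
      rw [mulVec_sub]
      abel
    rw [e]
    refine (l2norm_sub_le _ _).trans ?_
    linarith
  have h2 := hξ (c - c')
  rw [← mulVec_mulVec, dotProduct_mulVec, vecMul_transpose, ← l2norm_sq, ← l2norm_sq,
    ← mul_pow] at h2
  exact (abs_le_of_sq_le_sq' h2 (l2norm_nonneg _)).2.trans h1

/-- Minkowski's inequality leaves the `L²` distance of two surrogates, which by Parseval is the
distance of their coefficients, hence at most `2 * T / η`. -/
theorem rrmse_le_of_mem_gramLowerBound {ν : Fin d → Measure ℝ}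
    [∀ i, IsProbabilityMeasure (ν i)] {r : Fin d → ℕ}
    (hP : ∀ i, IsOrthonormalUpTo (ν i) (P i) (r i)) (hB : ∀ k ∈ B, ∀ i, k i ≤ r i) {η : ℝ}
    {ξ : Fin N → Fin d → ℝ} (hη : 0 < η) (hξ : ξ ∈ gramLowerBound N P B w (η ^ 2))
    {u : (Fin d → ℝ) → ℝ} (hu : MemLp u 2 (Measure.pi ν)) {c c' : B → ℝ} {T L : ℝ}
    (hc : residual P B w ξ u c ≤ T) (hc' : residual P B w ξ u c' ≤ T)
    (hT : T ≤ L * rmse (Measure.pi ν) u (surrogate P B c)) :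
    rrmse (Measure.pi ν) u (surrogate P B c') ≤
      (1 + 2 * L / η) * rrmse (Measure.pi ν) u (surrogate P B c) := by
  rw [rrmse, rrmse, ← mul_div_assoc]
  refine div_le_div_of_nonneg_right ?_ (Real.sqrt_nonneg _)
  refine (rmse_le_add hu (memLp_surrogate hP hB c') (memLp_surrogate hP hB c)).trans ?_
  simp only [← surrogate_sub]
  rw [integral_surrogate_sq hP hB, ← l2norm_sq, Real.sqrt_sq (l2norm_nonneg _), add_mul, one_mul]
  have h := l2norm_sub_le_of_residual_le hξ hc' hc
  have h2 : l2norm (c' - c) ≤ 2 * T / η := by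
    rw [le_div_iff₀ hη, mul_comm]
    exact h
  have h3 : 2 * T / η ≤ 2 * (L * rmse (Measure.pi ν) u (surrogate P B c)) / η := by gcongr
  have h4 : 2 * L / η * rmse (Measure.pi ν) u (surrogate P B c) =
    2 * (L * rmse (Measure.pi ν) u (surrogate P B c)) / η := by ring
  linarith

end Design

/-! ### Lower bound for the Gram matrix of independent samples, and its transfer by coupling. -/

section Probability

variable {d N : ℕ} {P : Fin d → ℕ → Polynomial ℝ} {B : Finset (Fin d → ℕ)}

theorem isIsotropicBounded_weightedBasis {Ω : Set (Fin d → ℝ)} {g : Measure (Fin d → ℝ)}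
    {w : (Fin d → ℝ) → ℝ} (hΩ : ∀ᵐ x ∂g, x ∈ Ω) (hw : Measurable w) (hiso : IsIsotropic g P B w)
    (hbdd : BddAbove (coherenceSet Ω P B w B.card)) :
    IsIsotropicBounded g (weightedBasis P B w) (coherence Ω P B w B.card) where
  measurable k := hw.mul (continuous_pcBasis P k).measurable
  bound := by
    filter_upwards [hΩ] with x hx
    -- At sparsity `|B|` the whole basis is an admissible subset, so the coherence bounds the full
    -- row.
    refine le_csSup hbdd ⟨x, hx, Finset.univ, by simp, ?_⟩
    refine Finset.sum_congr rfl fun k _ => ?_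
    rw [sq_abs, pow_two, weightedBasis]
  isotropic k l := by
    rw [← hiso k l]
    refine integral_congr_ae (Filter.Eventually.of_forall fun x => ?_)
    simp only [weightedBasis]
    ring

/-- The order of the resolvent power used in the tail bound is controlled by the sampling rate. -/
theorem ceil_le_of_two_le {n : ℕ} (hn : 2 ≤ n) {C : ℝ} (hC : 0 < C) :
    (⌈8 * (Real.log n + C + Real.log 2)⌉₊ : ℝ) ≤ 36 * ((C + Real.log 2) * Real.log n) := by
  have hl2 : (1 / 2 : ℝ) ≤ Real.log 2 := by linarith [Real.log_two_gt_d9]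
  have hln : (1 / 2 : ℝ) ≤ Real.log n :=
    hl2.trans (Real.log_le_log (by norm_num) (by exact_mod_cast hn))
  have h := (Nat.ceil_lt_add_one (a := 8 * (Real.log n + C + Real.log 2)) (by linarith)).le
  -- For `x, y ≥ 1/2`, `x + y ≤ 2xy + 1/2` and `1 ≤ 4xy`, so `8(x + y) + 1 ≤ 16xy + 5 ≤ 36xy`.
  nlinarith [mul_nonneg (sub_nonneg.2 hln) (show 0 ≤ C + Real.log 2 - 1 / 2 by linarith)]

theorem measure_pi_compl_gramLowerBound_le {g : Measure (Fin d → ℝ)} [IsProbabilityMeasure g]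
    {w : (Fin d → ℝ) → ℝ} {μ : ℝ} (h : IsIsotropicBounded g (weightedBasis P B w) μ)
    (hB : 1 < B.card) {C : ℝ} (hC : 0 < C)
    (hN : 10000 * ((C + Real.log 2) * Real.log B.card) * μ ≤ N) :
    (Measure.pi fun _ : Fin N => g) (gramLowerBound N P B w (3 / 4))ᶜ ≤
      ENNReal.ofReal (Real.exp (-C) / 2) := by
  have hne : Nonempty B := by
    obtain ⟨k, hk⟩ := Finset.card_pos.1 (zero_lt_one.trans hB)
    exact ⟨⟨k, hk⟩⟩
  have hμ := h.bound_pos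
  have hl2 : 0 < Real.log 2 := Real.log_pos (by norm_num)
  have hln : 0 < Real.log B.card := Real.log_pos (by exact_mod_cast hB)
  set a := 8 * (Real.log B.card + C + Real.log 2) with ha
  set p := ⌈a⌉₊ with hp
  have hap : a ≤ p := Nat.le_ceil a
  have hp0 : (0 : ℝ) < p := by linarith
  -- The constant `10000` leaves room for `256 * 36 = 9216`.
  have hpN : 256 * (p * μ) ≤ N := by
    refine le_trans ?_ hN
    have := mul_le_mul_of_nonneg_right (ceil_le_of_two_le hB hC) hμ.le
    have h0 : 0 ≤ (C + Real.log 2) * Real.log B.card * μ := by positivity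
    linarith
  have hN0 : (0 : ℝ) < N := by
    have : 0 < p * μ := mul_pos hp0 hμ
    linarith
  have hτ : (7 / 8 : ℝ) ≤ Real.exp (-(1 / 8)) := by
    linarith [Real.add_one_le_exp (-(1 / 8) : ℝ)]
  -- This `s` gives equality in `p * μ ≤ ε * s`, and `s ≤ N / 16`. With `τ ≥ 7/8` the spectral bound
  -- is at least `(7/8)(s + 15N/16) - s ≥ 13N/16`, above the required `3N/4`.
  have hmain := h.measure_pi_le (s := 16 * (p * μ)) (ε := 1 / 16) (τ := Real.exp (-(1 / 8)))
    (p := p) (by positivity) (by norm_num) (by linarith) (by norm_num) (Real.exp_pos _) N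
  refine (measure_mono ?_).trans (hmain.trans ?_)
  · intro ξ hξ hall
    refine hξ fun x => ?_
    rw [transpose_designMatrix_mul_designMatrix, smul_mulVec, dotProduct_smul, smul_eq_mul,
      le_inv_mul_iff₀ hN0]
    refine le_trans ?_ (hall x)
    rw [← mul_assoc]
    have hx : 0 ≤ x ⬝ᵥ x := by
      rw [← l2norm_sq]
      positivity
    refine mul_le_mul_of_nonneg_right ?_ hx
    have : 0 ≤ (Real.exp (-(1 / 8)) - 7 / 8) * (16 * (p * μ) + N * (1 - 1 / 16)) :=
      mul_nonneg (by linarith) (by positivity)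
    have h0 : 0 < p * μ := mul_pos hp0 hμ
    nlinarith
  · refine ENNReal.ofReal_le_ofReal ?_
    have hcard : (0 : ℝ) < B.card := by exact_mod_cast zero_lt_one.trans hB
    rw [Fintype.card_coe, ← Real.exp_nat_mul]
    calc (B.card : ℝ) * Real.exp (p * -(1 / 8))
        ≤ B.card * Real.exp (-(Real.log B.card + C + Real.log 2)) := by
          gcongr
          linarith
      _ = Real.exp (-C) / 2 := by
          rw [show -(Real.log B.card + C + Real.log 2) =
            -C - Real.log B.card - Real.log 2 by ring, Real.exp_sub, Real.exp_sub,
            Real.exp_log hcard, Real.exp_log (by norm_num)]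
          field_simp

/-- A Gram matrix close in operator norm to one bounded below is bounded below. -/
theorem mem_gramLowerBound_of_opNorm_le {w w' : (Fin d → ℝ) → ℝ} {ξ ξ' : Fin N → Fin d → ℝ}
    {t η : ℝ} (h : opNorm ((designMatrix P B w ξ)ᵀ * designMatrix P B w ξ -
      (designMatrix P B w' ξ')ᵀ * designMatrix P B w' ξ') ≤ t)
    (h' : ξ' ∈ gramLowerBound N P B w' η) : ξ ∈ gramLowerBound N P B w (η - t) := by
  intro x
  have h1 := dotProduct_mulVec_le_opNorm ((designMatrix P B w ξ)ᵀ * designMatrix P B w ξ -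
      (designMatrix P B w' ξ')ᵀ * designMatrix P B w' ξ') x
  rw [sub_mulVec, dotProduct_sub] at h1
  have hx : 0 ≤ x ⬝ᵥ x := by
    rw [← l2norm_sq]
    positivity
  have h2 := mul_le_mul_of_nonneg_right h hx
  have h3 := h' x
  have h4 := (abs_le.1 h1).1
  linarith

end Probability
end BasePC

/-! ### The recovery theorem: choice of constants and union bound. -/

theorem mainTheorem4 (t : ℝ) (ht : t = 3 / (4 + Real.sqrt 6)) :
    ∃ D₁ : ℝ → ℝ, ∀ β κ : ℝ, 0 < κ → ∃ κ' : ℝ, 0 < κ' ∧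
      -- input variables, orthonormal polynomials, basis
      ∀ (d : ℕ) (ν : Fin d → Measure ℝ) (_ : ∀ i, IsProbabilityMeasure (ν i))
        (P : Fin d → ℕ → Polynomial ℝ) (B : Finset (Fin d → ℕ)) (r : Fin d → ℕ)
        (_ : ∀ i, BasePC.IsOrthonormalUpTo (ν i) (P i) (r i))
        (_ : ∀ k ∈ B, ∀ i, k i ≤ r i) (_ : 1 < B.card)
        -- joint law of the samples and their weight function
        (N : ℕ) (Q : Measure (Fin N → Fin d → ℝ)) (_ : IsProbabilityMeasure Q)
        (w : (Fin d → ℝ) → ℝ) (_ : Measurable w)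
        -- the coupled independent sampling, on the domain `Ω`
        (Ω : Set (Fin d → ℝ)) (g : Measure (Fin d → ℝ)) (_ : IsProbabilityMeasure g)
        (_ : ∀ᵐ x ∂g, x ∈ Ω) (wg : (Fin d → ℝ) → ℝ) (_ : Measurable wg)
        (_ : BasePC.IsIsotropic g P B wg)
        (_ : BddAbove (BasePC.coherenceSet Ω P B wg B.card))
        (_ : BasePC.NonSparseCoupled Ω P B Q w g wg t β κ)
        (C : ℝ)
        (_ : (C + Real.log (2 * max β 1)) * κ'⁻¹ * BasePC.coherence Ω P B wg B.card
          * Real.log B.card ≤ (N : ℝ)),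
        ∃ A : Set (Fin N → Fin d → ℝ), MeasurableSet A ∧ 1 - Real.exp (-C) ≤ Q.real A ∧
          ∀ ξ ∈ A, ∀ (u : (Fin d → ℝ) → ℝ) (_ : MemLp u 2 (Measure.pi ν))
            (_ : 0 < ∫ x, u x ^ 2 ∂(Measure.pi ν))
            (c_tilde : B → ℝ) (_ : BasePC.IsBestApprox (Measure.pi ν) P B u c_tilde)
            (δ L : ℝ)
            (_ : BasePC.residual P B w ξ u c_tilde ≤ BasePC.tolerance w ξ u δ)
            (_ : BasePC.tolerance w ξ u δ ≤
              L * BasePC.rmse (Measure.pi ν) u (BasePC.surrogate P B c_tilde))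
            (c_hat : B → ℝ) (_ : BasePC.IsL1Solution P B w ξ u δ c_hat),
            BasePC.rrmse (Measure.pi ν) u (BasePC.surrogate P B c_hat) ≤
              D₁ L * BasePC.rrmse (Measure.pi ν) u (BasePC.surrogate P B c_tilde) := by
  have ht2 : t ≤ 1 / 2 := by
    have : (2 : ℝ) ≤ Real.sqrt 6 := Real.le_sqrt_of_sq_le (by norm_num)
    rw [ht, div_le_div_iff₀ (by linarith) (by norm_num)]
    linarith
  -- Here `1 / 2` is the lower bound `η` for the singular values of `D`. The minimum in `κ'` serves
  -- the coupling and the independent tail bound at once.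
  refine ⟨fun L => 1 + 2 * L / (1 / 2), fun β κ hκ => ⟨min κ (1 / 10000), by positivity, ?_⟩⟩
  intro d ν hν P B r hP hB hcard N Q hQ w hw Ω g hg hΩ wg hwg hiso hbdd hcoup C hN
  -- For `C ≤ 0` the required probability is at most `0`, and the empty event suffices.
  rcases le_or_gt C 0 with hC | hC
  · refine ⟨∅, MeasurableSet.empty, ?_, fun ξ hξ => absurd hξ (Set.notMem_empty ξ)⟩
    have := Real.one_le_exp (neg_nonneg.2 hC)
    simp only [measureReal_empty]
    linarith
  refine ⟨BasePC.gramLowerBound N P B w ((1 / 2) ^ 2),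
    BasePC.measurableSet_gramLowerBound hw _, ?_, ?_⟩
  swap
  · intro ξ hξ u hu _ c _ δ L hc hT c' hc'
    exact BasePC.rrmse_le_of_mem_gramLowerBound hP hB (by norm_num) hξ hu hc hc'.1 hT
  have hib := BasePC.isIsotropicBounded_weightedBasis hΩ hwg hiso hbdd
  set μ := BasePC.coherence Ω P B wg B.card with hμd
  have hne : Nonempty B := by
    obtain ⟨k, hk⟩ := Finset.card_pos.1 (zero_lt_one.trans hcard)
    exact ⟨⟨k, hk⟩⟩
  have hμ : 0 < μ := hib.bound_pos
  have hl2 : 0 < Real.log 2 := Real.log_pos (by norm_num)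
  have hln : 0 < Real.log B.card := Real.log_pos (by exact_mod_cast hcard)
  have hβ1 : 1 ≤ max β 1 := le_max_right _ _
  have hlβ : Real.log 2 ≤ Real.log (2 * max β 1) :=
    Real.log_le_log (by norm_num) (by linarith)
  have hκ' : 0 < min κ (1 / 10000) := by positivity
  have hNiid : 10000 * ((C + Real.log 2) * Real.log B.card) * μ ≤ N := by
    refine le_trans ?_ hN
    have h1 : (10000 : ℝ) ≤ (min κ (1 / 10000))⁻¹ := by
      rw [le_inv_comm₀ (by norm_num) hκ']
      exact (min_le_right _ _).trans (by norm_num)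
    calc 10000 * ((C + Real.log 2) * Real.log B.card) * μ
        = (C + Real.log 2) * 10000 * μ * Real.log B.card := by ring
      _ ≤ _ := by
        have : 0 ≤ C + Real.log (2 * max β 1) := by linarith
        gcongr
  have hiid := BasePC.measure_pi_compl_gramLowerBound_le hib hcard hC hNiid
  obtain ⟨J, hJ1, hJ2, hJ⟩ := hcoup
  have hJp : IsProbabilityMeasure J := by
    refine ⟨?_⟩
    have h1 : J.map Prod.fst Set.univ = 1 := by rw [hJ1]; exact measure_univ
    rwa [Measure.map_apply measurable_fst MeasurableSet.univ, Set.preimage_univ] at h1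
  -- The term `log (2 * max β 1)` in the sampling rate cancels the prefactor `β` and gains the
  -- factor `1/2`; the other half of `exp (-C)` pays for the independent samples.
  have hexp : β * Real.exp (-(κ * N / (μ * Real.log B.card))) ≤ Real.exp (-C) / 2 := by
    have h1 : C + Real.log (2 * max β 1) ≤ κ * N / (μ * Real.log B.card) := by
      rw [le_div_iff₀ (by positivity)]
      have h2 := mul_le_mul_of_nonneg_left hN hκ'.le
      have h3 : min κ (1 / 10000) * (N : ℝ) ≤ κ * N :=
        mul_le_mul_of_nonneg_right (min_le_left _ _) N.cast_nonneg
      refine le_trans (le_of_eq ?_) (h2.trans h3)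
      field_simp
    calc β * Real.exp (-(κ * N / (μ * Real.log B.card)))
        ≤ max β 1 * Real.exp (-(C + Real.log (2 * max β 1))) := by
          gcongr
          exact le_max_left _ _
      _ = Real.exp (-C) / 2 := by
          rw [neg_add, Real.exp_add, Real.exp_neg (Real.log _), Real.exp_log (by linarith)]
          have : max β 1 ≠ 0 := by linarith
          field_simp
  have hbad : Q.real (BasePC.gramLowerBound N P B w ((1 / 2) ^ 2))ᶜ ≤ Real.exp (-C) := by
    have hm := (BasePC.measurableSet_gramLowerBound (N := N) (P := P) (B := B) hw
      ((1 / 2) ^ 2)).compl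
    have hm' := (BasePC.measurableSet_gramLowerBound (N := N) (P := P) (B := B) hwg (3 / 4)).compl
    rw [← hJ1, map_measureReal_apply measurable_fst hm]
    have hiid' : J.real (Prod.snd ⁻¹' (BasePC.gramLowerBound N P B wg (3 / 4))ᶜ) ≤
        Real.exp (-C) / 2 := by
      rw [← map_measureReal_apply measurable_snd hm', hJ2]
      exact ENNReal.toReal_le_of_le_ofReal (by positivity) hiid
    refine (measureReal_mono ?_).trans ((measureReal_union_le _ _).trans
      ((add_le_add (hJ.trans hexp) hiid').trans (by linarith)))
    intro q hq
    by_contra hnot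
    rw [Set.mem_union, not_or] at hnot
    refine hq fun x => ?_
    have h1 := BasePC.mem_gramLowerBound_of_opNorm_le (not_lt.1 hnot.1) (not_not.1 hnot.2) x
    -- Off both bad events the bound is `3/4 - t ≥ 1/4 = (1/2)²`.
    refine le_trans (mul_le_mul_of_nonneg_right (by linarith) ?_) h1
    rw [← BasePC.l2norm_sq]
    positivity
  rw [probReal_compl_eq_one_sub (BasePC.measurableSet_gramLowerBound hw _)] at hbad
  linarith
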